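/- Let $G$ be the Euclidean group $E(2)$ or, more generally, any three-dimensional real Lie group whose Lie algebra $\mathfrak g$ is isomorphic to the Lie algebra of the group of rigid motions of the plane. Call a basis $V_1,V_2,V_3$ of $\mathfrak g$ a Milnor basis if $$[V_1,V_2]=0,\qquad [V_2,V_3]=2V_1,\qquad [V_3,V_1]=2V_2 ,$$ that is, $[V_i,V_j]=\sum_k\epsilon_{ijk}\lambda_kV_k$ with $(\lambda_1,\lambda_2,\lambda_3)=(2,2,0)$. Let $T$ be a left-invariant $(0,2)$-tensor field on $G$. A solution is a pair $(g,c)$ consisting of a left-invariant Riemannian metric $g$ on $G$ and a real number $c>0$ such that $\mathrm{Ric}(g)=cT$, where $\mathrm{Ric}(g)$ is the Ricci curvature of $g$. A solution exists if and only if there is a Milnor basis $V_1,V_2,V_3$ in which $T$ is diagonal, $T(V_i,V_j)=\delta_{ij}T_i$, with (i) $T_1=T_2=T_3=0$, or (ii) $T_1+T_2>0$, $T_3<0$ and $T_1T_2<0$. If $T$ is diagonal in some Milnor basis with entries as in (i), there are infinitely many solutions, even up to scaling of the metric: for every $c>0$ there are infinitely many left-invariant metrics $g$, no two of them proportional, such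 that $(g,c)$ is a solution. If $T$ is diagonal in some Milnor basis with entries as in (ii), the solution is unique up to scaling of $g$: there is a solution $(g,c)$, and every solution $(\bar g,\bar c)$ satisfies $\bar c=c$ and $\bar g=k g$ for some constant $k>0$. -/

import Mathlib

open scoped Manifold ContDiff

section RiemannianManifold

variable {E : Type*} [NormedAddCommGroup E] [NormedSpace ℝ E]
  {H : Type*} [TopologicalSpace H] {I : ModelWithCorners ℝ E H}
  {M : Type*} [TopologicalSpace M] [ChartedSpace H M]

/-- Smooth Riemannian metrics on the manifold `M`. -/
abbrev RiemMetric (I : ModelWithCorners ℝ E H) (M : Type*) [TopologicalSpace M] [ChartedSpace H M]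
    [IsManifold I ∞ M] : Type _ :=
  Bundle.ContMDiffRiemannianMetric I ∞ E (TangentSpace I : M → Type _)

/-- Connections (covariant derivatives) on the tangent bundle of `M`.
Mathlib writes `(∇_X Y)(x)` as `nabla Y x (X x)`. -/
abbrev TangentConnection (I : ModelWithCorners ℝ E H) (M : Type*) [TopologicalSpace M]
    [ChartedSpace H M] [IsManifold I ∞ M] : Type _ :=
  CovariantDerivative I E (TangentSpace I : M → Type _)

variable (I M) in
/-- `(0,2)`-tensor fields on `M`, i.e. a bilinear form on each tangent space. -/
abbrev TwoTensorField : Type _ :=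
  ∀ x : M, TangentSpace I x →L[ℝ] TangentSpace I x →L[ℝ] ℝ

/-- `∇` is the Levi-Civita connection of the Riemannian metric `g`: it satisfies
`∇_X Y - ∇_Y X = [X, Y]` and `u g(Y, Z) = g(∇_u Y, Z) + g(Y, ∇_u Z)`. -/
structure IsLeviCivita [IsManifold I ∞ M] (g : RiemMetric I M)
    (nabla : TangentConnection I M) : Prop where
  torsionFree : ∀ (X Y : ∀ x : M, TangentSpace I x) (x : M), MDiffAt (T% X) x → MDiffAt (T% Y) x →
    nabla Y x (X x) - nabla X x (Y x) = VectorField.mlieBracket I X Y x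
  metricCompatible : ∀ (Y Z : ∀ x : M, TangentSpace I x) (x : M) (u : TangentSpace I x),
    MDiffAt (T% Y) x → MDiffAt (T% Z) x →
    d% (fun y => g.inner y (Y y) (Z y)) x u
      = g.inner x (nabla Y x u) (Z x) + g.inner x (Y x) (nabla Z x u)

/-- The curvature `R(X, Y) Z = ∇_X ∇_Y Z - ∇_Y ∇_X Z - ∇_[X, Y] Z`, evaluated at `x`. -/
noncomputable def curvature [IsManifold I ∞ M] (nabla : TangentConnection I M)
    (X Y Z : ∀ x : M, TangentSpace I x) (x : M) : TangentSpace I x :=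
  nabla (fun y => nabla Z y (Y y)) x (X x) - nabla (fun y => nabla Z y (X y)) x (Y x)
    - nabla Z x (VectorField.mlieBracket I X Y x)

end RiemannianManifold

section LieGroup

variable {E : Type*} [NormedAddCommGroup E] [NormedSpace ℝ E]
  {H : Type*} [TopologicalSpace H] {I : ModelWithCorners ℝ E H}
  {G : Type*} [TopologicalSpace G] [ChartedSpace H G] [Group G]

/-- Mathlib puts the Lie algebra structure on `GroupLieAlgebra I G` under this assumption. -/
instance lieGroup_minSmoothness_three [LieGroup I ∞ G] : LieGroup I (minSmoothness ℝ 3) G := by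
  rw [minSmoothness_of_isRCLikeNormedField]
  infer_instance

/-- `S` is invariant under the left translations `x ↦ a * x`. -/
def IsLeftInvariant (S : TwoTensorField I G) : Prop :=
  ∀ (a x : G) (u v : TangentSpace I x),
    S (a * x) (mfderiv I I (fun y => a * y) x u) (mfderiv I I (fun y => a * y) x v) = S x u v

/-- `S` is the Ricci tensor of the connection `∇`: at each point, `S(v, w)` is the trace of
`u ↦ R(u, v) w`. As `R` is a tensor, it may be evaluated on any vector fields extending the given
tangent vectors; we take the left-invariant ones. They take every value at every point, hence the
condition determines `S`. -/
def IsRicciTensor [LieGroup I ∞ G] (nabla : TangentConnection I G) (S : TwoTensorField I G) :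
    Prop :=
  ∀ (x : G) (b c : GroupLieAlgebra I G), ∃ A : TangentSpace I x →ₗ[ℝ] TangentSpace I x,
    (∀ a : GroupLieAlgebra I G, A (mulInvariantVectorField a x) =
      curvature nabla (mulInvariantVectorField a) (mulInvariantVectorField b)
        (mulInvariantVectorField c) x) ∧
    LinearMap.trace ℝ (TangentSpace I x) A
      = S x (mulInvariantVectorField b x) (mulInvariantVectorField c x)

/-- `Ric(g) = S`, where `Ric(g)` is the Ricci tensor of the Levi-Civita connection of `g`. -/
def RicciEq [LieGroup I ∞ G] (g : RiemMetric I G) (S : TwoTensorField I G) : Prop :=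
  ∃ nabla : TangentConnection I G, IsLeviCivita g nabla ∧ IsRicciTensor nabla S

/-- `(g, c)` is a solution of the prescribed Ricci curvature problem `Ric(g) = c T`: `g` is a
left-invariant Riemannian metric and `c` is a positive constant. -/
def IsRicciSolution [LieGroup I ∞ G] (T : TwoTensorField I G) (g : RiemMetric I G) (c : ℝ) :
    Prop :=
  IsLeftInvariant g.inner ∧ 0 < c ∧ RicciEq g (fun x => c • T x)

/-- `g'` is a positive constant multiple of `g`. -/
def IsHomothetic [IsManifold I ∞ G] (g g' : RiemMetric I G) : Prop :=
  ∃ k : ℝ, 0 < k ∧ ∀ x : G, g'.inner x = k • g.inner x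

/-- The basis `V₁, V₂, V₃` of the Lie algebra satisfies `[V_i, V_j] = ∑_k ε_{ijk} l_k V_k`. -/
def IsMilnorBasis (V : Module.Basis (Fin 3) ℝ (GroupLieAlgebra I G)) (l₁ l₂ l₃ : ℝ) : Prop :=
  ⁅V 0, V 1⁆ = l₃ • V 2 ∧ ⁅V 1, V 2⁆ = l₁ • V 0 ∧ ⁅V 2, V 0⁆ = l₂ • V 1

/-- `T = diag(T₁, T₂, T₃)` in the basis `V₁, V₂, V₃` of the Lie algebra, the tangent space
at `1`. -/
def IsDiagIn (T : TwoTensorField I G) (V : Module.Basis (Fin 3) ℝ (GroupLieAlgebra I G))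
    (T₁ T₂ T₃ : ℝ) : Prop :=
  ∀ i j, T 1 (V i) (V j) = Matrix.diagonal ![T₁, T₂, T₃] i j

end LieGroup

section EuclideanMotions

attribute [local instance] LieRing.ofAssociativeRing

/-- The Lie algebra of the group of rigid motions `p ↦ R p + b` of the plane, realised by the
`3 × 3` matrices with block form `(R b; 0 1)`: the matrices `(J b; 0 0)` with `J` skew-symmetric. -/
def euclideanLieAlgebra : LieSubalgebra ℝ (Matrix (Fin 3) (Fin 3) ℝ) where
  carrier := {A | A 0 0 = 0 ∧ A 1 1 = 0 ∧ A 1 0 = -A 0 1 ∧ ∀ j, A 2 j = 0}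
  add_mem' := by
    rintro A B ⟨a, b, c, d⟩ ⟨a', b', c', d'⟩
    refine ⟨by simp [a, a'], by simp [b, b'], ?_, fun j => by simp [d, d']⟩
    simp only [Matrix.add_apply, c, c']
    ring
  zero_mem' := by simp
  smul_mem' := by
    rintro r A ⟨a, b, c, d⟩
    exact ⟨by simp [a], by simp [b], by simp [c], fun j => by simp [d]⟩
  lie_mem' := by
    rintro A B ⟨a, b, c, d⟩ ⟨a', b', c', d'⟩
    refine ⟨?_, ?_, ?_, fun j => ?_⟩ <;>
      simp only [Ring.lie_def, Matrix.sub_apply, Matrix.mul_apply, Fin.sum_univ_three, a, b, c, d,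
        a', b', c', d'] <;> ring

end EuclideanMotions

/-! Left translation trivializes the tangent bundle, so the problem reduces to algebra on the Lie
algebra. The Levi-Civita connection of a left-invariant metric acts on left-invariant fields by the
unique bilinear map `Γ` that is torsion-free and skew for the inner product; the Ricci tensor is the
trace of the curvature of `Γ` (`ricciEq_iff_trace`).

The span of `V 0`, `V 1` is an abelian ideal on which `ad (V 2)` is twice a quarter turn. Rotating
this plane and shearing `V 2` along it therefore preserves Milnor bases, and these moves diagonalize
any inner product (`exists_isDiagIn_metric`). If the metric is diag(x, y, z), then Ric is diagonal
with entries 2(x² - y²)/(yz), 2(y² - x²)/(xz), -2(x - y)²/(xy) (`ricciEq_iff_isDiagIn`).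

Everything follows from this formula. If x = y the metric is Ricci-flat for every z, which gives the
infinite family. If x ≠ y the signs are those of (ii). Conversely, in case (ii) a solution metric
must be diagonal in the same basis as `T` (`IsRicciSolution.exists_isDiagIn`); the quotient of the
first two entries is -x/y, the third entry then determines c, and the second determines z/y. Only
the scale of the metric stays free. -/

/-! ### Left trivialization of the tangent bundle -/

section LeftTrivialization

open Bundle VectorField

variable {E : Type*} [NormedAddCommGroup E] [NormedSpace ℝ E]
  {H : Type*} [TopologicalSpace H] {I : ModelWithCorners ℝ E H}
  {G : Type*} [TopologicalSpace G] [ChartedSpace H G] [Group G] [LieGroup I ∞ G]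

lemma mdifferentiable_mul_left_of_lieGroup (a : G) : MDifferentiable I I (fun y : G => a * y) :=
  (contMDiff_mul_left (I := I) (n := ∞)).mdifferentiable (by simp)

lemma mfderiv_mul_left_comp (a b x : G) (v : TangentSpace I x) :
    mfderiv I I (fun y => a * y) (b * x) (mfderiv I I (fun y => b * y) x v) =
      mfderiv I I (fun y => a * b * y) x v := by
  have h := mfderiv_comp x (mdifferentiable_mul_left_of_lieGroup (I := I) a (b * x))
    (mdifferentiable_mul_left_of_lieGroup b x)
  have h' : (fun y => a * y) ∘ (fun y => b * y) = fun y : G => a * b * y := by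
    ext y; simp [mul_assoc]
  rw [h'] at h
  rw [h]
  rfl

omit [LieGroup I ∞ G] in
lemma mfderiv_one_mul (x : G) (v : TangentSpace I x) :
    mfderiv I I (fun y : G => 1 * y) x v = v := by
  have : (fun y : G => 1 * y) = id := by ext; simp
  rw [this, mfderiv_id]
  rfl

/-- Left translation identifies the Lie algebra with the tangent space at `x`. -/
noncomputable def leftTriv (x : G) : GroupLieAlgebra I G ≃L[ℝ] TangentSpace I x where
  toFun a := mulInvariantVectorField a x
  map_add' a b := by rw [mulInvariantVectorField_add]; rfl
  map_smul' a b := by rw [mulInvariantVectorField_smul]; rfl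
  invFun v := mfderiv I I (fun y => x⁻¹ * y) x v
  left_inv a := by
    have h := mfderiv_mul_left_comp (I := I) x⁻¹ x 1 a
    have h1 : x⁻¹ * x = 1 := inv_mul_cancel x
    have h2 : x * 1 = x := mul_one x
    rw [h1, mfderiv_one_mul, h2] at h
    exact h
  right_inv v := by
    have h := mfderiv_mul_left_comp (I := I) x x⁻¹ x v
    have h1 : x * x⁻¹ = 1 := mul_inv_cancel x
    have h2 : x⁻¹ * x = 1 := inv_mul_cancel x
    rw [h1, mfderiv_one_mul, h2] at h
    exact h
  continuous_toFun := (mfderiv I I (fun y => x * y) 1).continuous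
  continuous_invFun := (mfderiv I I (fun y => x⁻¹ * y) x).continuous

@[simp] lemma leftTriv_apply (x : G) (a : GroupLieAlgebra I G) :
    leftTriv x a = mulInvariantVectorField a x := rfl

@[simp] lemma leftTriv_symm_mulInvariantVectorField (x : G) (a : GroupLieAlgebra I G) :
    (leftTriv x).symm (mulInvariantVectorField a x) = a := (leftTriv x).symm_apply_apply a

@[simp] lemma mulInvariantVectorField_leftTriv_symm (x : G) (v : TangentSpace I x) :
    mulInvariantVectorField ((leftTriv x).symm v) x = v := (leftTriv x).apply_symm_apply v

omit [LieGroup I ∞ G] in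
lemma mulInvariantVectorField_one (a : GroupLieAlgebra I G) :
    mulInvariantVectorField a (1 : G) = a := mfderiv_one_mul 1 a

lemma mfderiv_mulInvariantVectorField (a x : G) (v : GroupLieAlgebra I G) :
    mfderiv I I (fun y => a * y) x (mulInvariantVectorField v x) =
      mulInvariantVectorField v (a * x) := by
  have h := mfderiv_mul_left_comp (I := I) a x 1 v
  have h2 : x * 1 = x := mul_one x
  rw [h2] at h
  exact h

omit [LieGroup I ∞ G] in
/-- A left-invariant bilinear form is determined by its values at the identity. -/
lemma IsLeftInvariant.apply_mulInvariantVectorField {S : TwoTensorField I G}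
    (hS : IsLeftInvariant S) (x : G) (a b : GroupLieAlgebra I G) :
    S x (mulInvariantVectorField a x) (mulInvariantVectorField b x) = S 1 a b := by
  have h := hS x 1 a b
  have h2 : x * 1 = x := mul_one x
  rw [h2] at h
  exact h

lemma isLeftInvariant_iff {S : TwoTensorField I G} : IsLeftInvariant S ↔
    ∀ (x : G) (a b : GroupLieAlgebra I G),
      S x (mulInvariantVectorField a x) (mulInvariantVectorField b x) = S 1 a b := by
  refine ⟨fun h x a b => h.apply_mulInvariantVectorField x a b, fun h a x u v => ?_⟩
  obtain ⟨u, rfl⟩ := (leftTriv x).surjective u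
  obtain ⟨v, rfl⟩ := (leftTriv x).surjective v
  simp only [leftTriv_apply, mfderiv_mulInvariantVectorField, h]

/-- The inverse trivialization is the derivative of multiplication at (x⁻¹, x) applied to (0, v),
hence a composite of the zero section, inversion and the tangent map of multiplication, all smooth.
-/
lemma contMDiff_leftTriv_symm (α : GroupLieAlgebra I G →L[ℝ] ℝ) :
    ContMDiff I.tangent 𝓘(ℝ, ℝ) ∞ (fun p : TangentBundle I G => α ((leftTriv p.1).symm p.2)) := by
  let F₁ : TangentBundle I G → TangentBundle I G × TangentBundle I G :=
    fun p => (TotalSpace.mk' E p.1⁻¹ 0, p)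
  have hproj : ContMDiff I.tangent I ∞ (fun p : TangentBundle I G => p.1) := contMDiff_proj _
  have S₁ : ContMDiff I.tangent (I.tangent.prod I.tangent) ∞ F₁ :=
    ((contMDiff_zeroSection ℝ (TangentSpace I : G → Type _)).comp
      ((contMDiff_inv I ∞).comp hproj)).prodMk contMDiff_id
  let F₂ : (TangentBundle I G × TangentBundle I G) → TangentBundle (I.prod I) (G × G) :=
    (equivTangentBundleProd I G I G).symm
  have S₂ : CMDiff ∞ F₂ := contMDiff_equivTangentBundleProd_symm
  let F₃ : TangentBundle (I.prod I) (G × G) → TangentBundle I G :=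
    tangentMap (I.prod I) I (fun (p : G × G) ↦ p.1 * p.2)
  have S₃ : CMDiff ∞ F₃ :=
    ContMDiff.contMDiff_tangentMap (contMDiff_mul I ∞) (m := ∞) le_rfl
  have S : ContMDiff I.tangent I.tangent ∞ (fun p : TangentBundle I G =>
      (TotalSpace.mk' E (1 : G) ((leftTriv p.1).symm p.2) : TangentBundle I G)) := by
    convert! (S₃.comp S₂).comp S₁ with p
    · simp [F₁, F₂, F₃]
    · simp only [Function.comp_apply, tangentMap, F₃, F₂, F₁]
      rw [mfderiv_prod_eq_add_apply ((contMDiff_mul I ∞).mdifferentiableAt (by simp))]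
      refine Eq.symm (Eq.trans (congrArg₂ (· + ·) (?_ : _ = (0 : E)) rfl) (zero_add _))
      exact ContinuousLinearMap.map_zero (mfderiv I I (fun z : G => z * p.1) p.1⁻¹)
  intro p
  have h := (contMDiffAt_totalSpace.1 (S p)).2
  let α' : E →L[ℝ] ℝ := α
  have := (α'.contMDiff (n := ∞) _).comp p h
  refine this.congr_of_eventuallyEq (Filter.Eventually.of_forall fun q => ?_)
  simp only [Function.comp_apply]
  refine congrArg α' ?_
  -- All values lie over the single point 1, where the fibre coordinate is a change from a chart to
  -- itself.
  exact ((tangentBundleCore I G).coordChange_self (achart H 1) 1 (mem_chart_source H 1) _).symm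

end LeftTrivialization

/-! ### Left-invariant forms and diagonal metrics -/

section LeftInvariantForms

open Bundle VectorField

variable {E : Type*} [NormedAddCommGroup E] [NormedSpace ℝ E]
  {H : Type*} [TopologicalSpace H] {I : ModelWithCorners ℝ E H}

/-- In finite dimension an operator is a fixed finite sum of its values on a basis times the
coordinate functionals. -/
lemma contMDiffAt_clm_of_apply [FiniteDimensional ℝ E] {F : Type*} [NormedAddCommGroup F]
    [NormedSpace ℝ F] {M : Type*} [TopologicalSpace M] [ChartedSpace H M] {n : ℕ∞ω}
    {f : M → E →L[ℝ] F} {x : M}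
    (h : ∀ v, ContMDiffAt I 𝓘(ℝ, F) n (fun y => f y v) x) :
    ContMDiffAt I 𝓘(ℝ, E →L[ℝ] F) n f x := by
  let b := Module.finBasis ℝ E
  have key : f = fun y => ∑ i, ContinuousLinearMap.smulRightL ℝ E F
      (b.coord i).toContinuousLinearMap (f y (b i)) := by
    ext y v
    calc f y v = f y (∑ i, b.repr v i • b i) := by rw [b.sum_repr]
      _ = _ := by rw [map_sum]; simp
  rw [key]
  exact contMDiffAt_finsetSum fun i _ =>
    (ContinuousLinearMap.contMDiff _ _).comp x (h (b i))

variable {G : Type*} [TopologicalSpace G] [ChartedSpace H G] [Group G] [LieGroup I ∞ G]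

/-- The left-invariant one-form with value `α` at the identity. -/
noncomputable def leftForm (α : GroupLieAlgebra I G →L[ℝ] ℝ) (x : G) : TangentSpace I x →L[ℝ] ℝ :=
  α.comp (leftTriv x).symm.toContinuousLinearMap

lemma leftForm_apply (α : GroupLieAlgebra I G →L[ℝ] ℝ) (x : G) (v : TangentSpace I x) :
    leftForm α x v = α ((leftTriv x).symm v) := rfl

@[simp] lemma leftForm_mulInvariantVectorField (α : GroupLieAlgebra I G →L[ℝ] ℝ) (x : G)
    (a : GroupLieAlgebra I G) : leftForm α x (mulInvariantVectorField a x) = α a := by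
  rw [leftForm_apply, leftTriv_symm_mulInvariantVectorField]

lemma MDifferentiableAt.leftForm {Z : ∀ x : G, TangentSpace I x} {x : G}
    (hZ : MDiffAt (T% Z) x) (α : GroupLieAlgebra I G →L[ℝ] ℝ) :
    MDifferentiableAt I 𝓘(ℝ, ℝ) (fun y => leftForm α y (Z y)) x :=
  ((contMDiff_leftTriv_symm α).mdifferentiable (by simp) _).comp x hZ

lemma contMDiff_leftForm [FiniteDimensional ℝ E] (α : GroupLieAlgebra I G →L[ℝ] ℝ) :
    ContMDiff I (I.prod 𝓘(ℝ, E →L[ℝ] ℝ)) ∞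
      (fun x : G => TotalSpace.mk' (E →L[ℝ] ℝ)
        (E := fun x : G => TangentSpace I x →L[ℝ] Bundle.Trivial G ℝ x) x (leftForm α x)) := by
  intro x
  rw [contMDiffAt_hom_bundle]
  refine ⟨contMDiffAt_id, contMDiffAt_clm_of_apply fun v => ?_⟩
  -- Testing the form on the local field with constant coordinates `v` reduces its smoothness to
  -- that of a function on the total space.
  have hs : ContMDiffAt I I.tangent ∞ (fun y : G => TotalSpace.mk' E y
      ((trivializationAt E (TangentSpace I : G → Type _) x).symm y v)) x := by
    rw [(trivializationAt E (TangentSpace I : G → Type _) x).contMDiffAt_section_iff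
      (mem_baseSet_trivializationAt E _ x)]
    refine (contMDiffAt_const (c := v)).congr_of_eventuallyEq ?_
    filter_upwards [(trivializationAt E (TangentSpace I : G → Type _) x).open_baseSet.mem_nhds
      (mem_baseSet_trivializationAt E _ x)] with y hy
    simp [Trivialization.apply_mk_symm _ hy]
  refine ((contMDiff_leftTriv_symm α _).comp x hs).congr_of_eventuallyEq ?_
  filter_upwards [(trivializationAt E (TangentSpace I : G → Type _) x).open_baseSet.mem_nhds
      (mem_baseSet_trivializationAt E _ x)] with y hy
  rw [ContinuousLinearMap.inCoordinates_eq hy (Set.mem_univ _)]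
  simp [leftForm]

instance tangentSpace_t2Space {M : Type*} [TopologicalSpace M] [ChartedSpace H M] (x : M) :
    T2Space (TangentSpace I x) := inferInstanceAs (T2Space E)

instance tangentSpace_finiteDimensional [FiniteDimensional ℝ E] {M : Type*} [TopologicalSpace M]
    [ChartedSpace H M] (x : M) : FiniteDimensional ℝ (TangentSpace I x) :=
  inferInstanceAs (FiniteDimensional ℝ E)

/-- The left-invariant coframe dual to the basis `V` of the Lie algebra. -/
noncomputable def coframe [FiniteDimensional ℝ E] {ι : Type*}
    (V : Module.Basis ι ℝ (GroupLieAlgebra I G)) (i : ι) (x : G) : TangentSpace I x →L[ℝ] ℝ :=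
  leftForm (LinearMap.toContinuousLinearMap (V.coord i)) x

lemma coframe_apply [FiniteDimensional ℝ E] {ι : Type*}
    (V : Module.Basis ι ℝ (GroupLieAlgebra I G)) (i : ι) (x : G) (v : TangentSpace I x) :
    coframe V i x v = V.repr ((leftTriv x).symm v) i := rfl

@[simp] lemma coframe_mulInvariantVectorField [FiniteDimensional ℝ E] {ι : Type*}
    (V : Module.Basis ι ℝ (GroupLieAlgebra I G)) (i : ι) (x : G) (a : GroupLieAlgebra I G) :
    coframe V i x (mulInvariantVectorField a x) = V.repr a i := by
  rw [coframe_apply, leftTriv_symm_mulInvariantVectorField]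

lemma sum_coframe_smul [FiniteDimensional ℝ E] {ι : Type*} [Fintype ι]
    (V : Module.Basis ι ℝ (GroupLieAlgebra I G)) (x : G) (v : TangentSpace I x) :
    ∑ i, coframe V i x v • mulInvariantVectorField (V i) x = v := by
  obtain ⟨a, rfl⟩ := (leftTriv x).surjective v
  simp only [leftTriv_apply, coframe_mulInvariantVectorField]
  simp only [← leftTriv_apply, ← map_smul, ← map_sum, V.sum_repr]

lemma contMDiff_smulRight_leftForm [FiniteDimensional ℝ E] (α β : GroupLieAlgebra I G →L[ℝ] ℝ) :
    ContMDiff I (I.prod 𝓘(ℝ, E →L[ℝ] E →L[ℝ] ℝ)) ∞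
      (fun x : G => TotalSpace.mk' (E →L[ℝ] E →L[ℝ] ℝ)
        (E := fun x : G => TangentSpace I x →L[ℝ] TangentSpace I x →L[ℝ] ℝ) x
          ((leftForm α x).smulRight (leftForm β x))) := by
  intro x
  rw [contMDiffAt_hom_bundle]
  refine ⟨contMDiffAt_id, ?_⟩
  have hα := ((contMDiffAt_hom_bundle _).1 (contMDiff_leftForm α x)).2
  have hβ := ((contMDiffAt_hom_bundle _).1 (contMDiff_leftForm β x)).2
  refine contMDiffAt_clm_of_apply fun v => contMDiffAt_clm_of_apply fun w => ?_
  refine ((hα.clm_apply (contMDiffAt_const (c := v))).mul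
    (hβ.clm_apply (contMDiffAt_const (c := w)))).congr_of_eventuallyEq ?_
  filter_upwards [(trivializationAt E (TangentSpace I : G → Type _) x).open_baseSet.mem_nhds
      (mem_baseSet_trivializationAt E _ x)] with y hy
  have hy' : y ∈ (trivializationAt (E →L[ℝ] ℝ)
      (fun b : G => TangentSpace I b →L[ℝ] Bundle.Trivial G ℝ b) x).baseSet :=
    ⟨hy, Set.mem_univ _⟩
  rw [ContinuousLinearMap.inCoordinates_eq hy hy']
  simp only [ContinuousLinearMap.comp_apply, ContinuousLinearEquiv.coe_coe,
    ContinuousLinearMap.smulRight_apply, map_smul, _root_.smul_apply, Pi.mul_apply,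
    smul_eq_mul]
  congr 1
  rw [ContinuousLinearMap.inCoordinates_eq hy (Set.mem_univ _)]
  simp

/-- The left-invariant metric which is at `1` diagonal with entries `d` in the basis `V`. -/
noncomputable def diagMetric [FiniteDimensional ℝ E] {ι : Type*} [Fintype ι]
    (V : Module.Basis ι ℝ (GroupLieAlgebra I G)) (d : ι → ℝ) (hd : ∀ i, 0 < d i) :
    RiemMetric I G where
  inner x := ∑ i, d i • (coframe V i x).smulRight (coframe V i x)
  symm x v w := by simp [mul_comm]
  pos x v hv := by
    have h : ∃ i, coframe V i x v ≠ 0 := by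
      by_contra! h
      exact hv (by rw [← sum_coframe_smul V x v]; simp [h])
    obtain ⟨i, hi⟩ := h
    simp only [_root_.sum_apply, _root_.smul_apply,
      ContinuousLinearMap.smulRight_apply, smul_eq_mul]
    exact Finset.sum_pos' (fun j _ => mul_nonneg (hd j).le (mul_self_nonneg _))
      ⟨i, Finset.mem_univ i, mul_pos (hd i) (mul_self_pos.2 hi)⟩
  isVonNBounded x := by
    let L : (ι → ℝ) →ₗ[ℝ] TangentSpace I x :=
      (leftTriv x).toLinearEquiv.toLinearMap ∘ₗ V.equivFun.symm.toLinearMap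
    have hball : Bornology.IsVonNBounded ℝ {w : ι → ℝ | ∀ i, d i * (w i * w i) < 1} := by
      rw [NormedSpace.isVonNBounded_iff, Bornology.forall_isBounded_image_eval_iff.symm]
      intro i
      -- The bound 1 + 1/d avoids a square root: w² < 1/d < (1 + 1/d)².
      refine (Metric.isBounded_Icc (-(1 + 1 / d i)) (1 + 1 / d i)).subset ?_
      rintro _ ⟨w, hw, rfl⟩
      have h1 : w i * w i < 1 / d i := by
        rw [lt_div_iff₀ (hd i), mul_comm]; exact hw i
      have h2 := one_div_pos.2 (hd i)
      exact abs_le.1 (abs_le_of_sq_le_sq (by nlinarith) (by linarith))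
    refine (hball.image (LinearMap.toContinuousLinearMap L)).subset fun v hv => ?_
    refine ⟨fun i => coframe V i x v, fun i => ?_, ?_⟩
    · simp only [_root_.sum_apply, _root_.smul_apply,
        ContinuousLinearMap.smulRight_apply, smul_eq_mul, Set.mem_ofPred_eq] at hv
      exact (Finset.single_le_sum (f := fun i => d i * (coframe V i x v * coframe V i x v))
        (fun j _ => mul_nonneg (hd j).le (mul_self_nonneg _)) (Finset.mem_univ i)).trans_lt hv
    · conv_rhs => rw [← sum_coframe_smul V x v]
      simp [L, V.equivFun_symm_apply]
  contMDiff := by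
    refine ContMDiff.sum_section fun i _ => ?_
    exact (contMDiff_smulRight_leftForm (LinearMap.toContinuousLinearMap (V.coord i))
      (LinearMap.toContinuousLinearMap (V.coord i))).const_smul_section (a := d i)

lemma diagMetric_inner_apply [FiniteDimensional ℝ E] {ι : Type*} [Fintype ι]
    (V : Module.Basis ι ℝ (GroupLieAlgebra I G)) (d : ι → ℝ) (hd : ∀ i, 0 < d i) (x : G)
    (a b : GroupLieAlgebra I G) :
    (diagMetric V d hd).inner x (mulInvariantVectorField a x) (mulInvariantVectorField b x) =
      ∑ i, d i * (V.repr a i * V.repr b i) := by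
  simp [diagMetric]

lemma isLeftInvariant_diagMetric [FiniteDimensional ℝ E] {ι : Type*} [Fintype ι]
    (V : Module.Basis ι ℝ (GroupLieAlgebra I G)) (d : ι → ℝ) (hd : ∀ i, 0 < d i) :
    IsLeftInvariant (diagMetric V d hd).inner := by
  rw [isLeftInvariant_iff]
  intro x a b
  have h := diagMetric_inner_apply V d hd 1 a b
  rw [mulInvariantVectorField_one, mulInvariantVectorField_one] at h
  rw [diagMetric_inner_apply, h]

end LeftInvariantForms

/-! ### Invariant connections and the Levi-Civita connection -/

section InvariantConnections

open Bundle VectorField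

variable {E : Type*} [NormedAddCommGroup E] [NormedSpace ℝ E] [FiniteDimensional ℝ E]
  {H : Type*} [TopologicalSpace H] {I : ModelWithCorners ℝ E H}
  {G : Type*} [TopologicalSpace G] [ChartedSpace H G] [Group G] [LieGroup I ∞ G]

omit [FiniteDimensional ℝ E] in
lemma mdifferentiableAt_mulInvariantVectorField' (a : GroupLieAlgebra I G) (x : G) :
    MDiffAt (T% (mulInvariantVectorField a : ∀ x : G, TangentSpace I x)) x :=
  mdifferentiableAt_mulInvariantVectorField a

lemma mlieBracket_mulInvariantVectorField (a b : GroupLieAlgebra I G) :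
    mlieBracket I (mulInvariantVectorField a) (mulInvariantVectorField b) =
      mulInvariantVectorField (G := G) ⁅a, b⁆ := by
  have : CompleteSpace E := FiniteDimensional.complete ℝ E
  rw [GroupLieAlgebra.bracket_def, mulInvariantVector_mlieBracket]

/-- The connection `∇` maps left-invariant fields to left-invariant fields, and `∇_a b = Γ(a, b)`
on the Lie algebra. -/
def IsInvariantConnection (nabla : TangentConnection I G)
    (Γ : GroupLieAlgebra I G →ₗ[ℝ] GroupLieAlgebra I G →ₗ[ℝ] GroupLieAlgebra I G) : Prop :=
  ∀ (x : G) (a b : GroupLieAlgebra I G),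
    nabla (mulInvariantVectorField b) x (mulInvariantVectorField a x) =
      mulInvariantVectorField (Γ a b) x

/-- The connection with `∇_a b = Γ(a, b)` on left-invariant fields. -/
noncomputable def invariantConnection {ι : Type*} [Fintype ι]
    (V : Module.Basis ι ℝ (GroupLieAlgebra I G))
    (Γ : GroupLieAlgebra I G →ₗ[ℝ] GroupLieAlgebra I G →ₗ[ℝ] GroupLieAlgebra I G) :
    TangentConnection I G where
  -- The Leibniz rule for Z = ∑ θᵢ(Z) Vᵢ: one term differentiates the coefficient, the other applies
  -- `Γ` to the frame.
  toFun Z x := ∑ i, ((mvfderiv I (fun y => coframe V i y (Z y)) x).smulRight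
      (mulInvariantVectorField (V i) x) + coframe V i x (Z x) •
      LinearMap.toContinuousLinearMap ((leftTriv x).toLinearEquiv.toLinearMap ∘ₗ
        Γ.flip (V i) ∘ₗ (leftTriv x).symm.toLinearEquiv.toLinearMap))
  isCovariantDerivativeOnUniv :=
    { add := by
        intro Z Z' x hZ hZ' _
        rw [← Finset.sum_add_distrib]
        refine Finset.sum_congr rfl fun i _ => ?_
        have h := mvfderiv_add (hZ.leftForm (LinearMap.toContinuousLinearMap (V.coord i)))
          (hZ'.leftForm (LinearMap.toContinuousLinearMap (V.coord i)))
        have e : (fun y => coframe V i y ((Z + Z') y)) =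
            (fun y => coframe V i y (Z y)) + fun y => coframe V i y (Z' y) := by
          ext y; simp
        rw [e]
        refine (congrArg₂ (· + ·) (congrArg (fun l => ContinuousLinearMap.smulRight l
          (mulInvariantVectorField (V i) x)) h) rfl).trans ?_
        ext u
        simp only [Pi.add_apply, map_add, add_apply, ContinuousLinearMap.smulRight_apply,
          add_smul, coframe]
        abel
      leibniz := by
        intro Z f x hZ hf _
        rw [Finset.smul_sum]
        have h : ∀ i, (mvfderiv I (fun y => coframe V i y ((f • Z) y)) x) =
            f x • mvfderiv I (fun y => coframe V i y (Z y)) x +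
              coframe V i x (Z x) • mvfderiv I f x := by
          intro i
          have e : (fun y => coframe V i y ((f • Z) y)) =
              f * fun y => coframe V i y (Z y) := by
            ext y; simp
          rw [e]
          exact mvfderiv_mul hf (hZ.leftForm (LinearMap.toContinuousLinearMap (V.coord i)))
        conv_rhs =>
          arg 2
          rw [← sum_coframe_smul V x (Z x)]
        ext u
        simp only [h]
        simp only [sum_apply, add_apply, smul_apply, ContinuousLinearMap.smulRight_apply,
          Finset.smul_sum, Pi.smul_apply', map_smul, ← Finset.sum_add_distrib]
        refine Finset.sum_congr rfl fun i _ => ?_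
        module }

lemma isInvariantConnection_invariantConnection {ι : Type*} [Fintype ι]
    (V : Module.Basis ι ℝ (GroupLieAlgebra I G))
    (Γ : GroupLieAlgebra I G →ₗ[ℝ] GroupLieAlgebra I G →ₗ[ℝ] GroupLieAlgebra I G) :
    IsInvariantConnection (invariantConnection V Γ) Γ := by
  intro x a b
  have h : ∀ i, (mvfderiv I (fun y => coframe V i y (mulInvariantVectorField b y)) x) = 0 := by
    intro i
    simp only [coframe_mulInvariantVectorField]
    exact mvfderiv_const _
  simp only [invariantConnection, h]
  simp only [zero_add, coframe_mulInvariantVectorField, sum_apply, add_apply, smul_apply,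
    ContinuousLinearMap.smulRight_apply, zero_apply, zero_smul]
  rw [← leftTriv_apply x (Γ a b)]
  conv_rhs => rw [← V.sum_repr b, map_sum, map_sum]
  exact Finset.sum_congr rfl fun i _ => by rw [map_smul, map_smul]; simp

omit [FiniteDimensional ℝ E] in
lemma mdifferentiableAt_inner (g : RiemMetric I G) {Y Z : ∀ x : G, TangentSpace I x} {x : G}
    (hY : MDiffAt (T% Y) x) (hZ : MDiffAt (T% Z) x) :
    MDiffAt (fun y => g.inner y (Y y) (Z y)) x := by
  have : MDifferentiableAt I (I.prod 𝓘(ℝ))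
      (fun m ↦ TotalSpace.mk' ℝ (E := Bundle.Trivial G ℝ) m (g.inner m (Y m) (Z m))) x := by
    apply MDifferentiableAt.clm_bundle_apply₂ (F₁ := E) (F₂ := E)
    · exact g.contMDiff.mdifferentiableAt (by simp)
    · exact hY
    · exact hZ
  simp only [mdifferentiableAt_totalSpace] at this
  exact this.2

omit [FiniteDimensional ℝ E] in
/-- The failure of the connection to be compatible with the metric is a tensor. -/
lemma tensorialAt_metricDefect (g : RiemMetric I G) (nabla : TangentConnection I G) (x : G)
    (u : TangentSpace I x) (Z : ∀ x : G, TangentSpace I x) (hZ : MDiffAt (T% Z) x) :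
    TensorialAt I E (fun Y : ∀ x : G, TangentSpace I x =>
      d% (fun y => g.inner y (Y y) (Z y)) x u
      - g.inner x (nabla Y x u) (Z x) - g.inner x (Y x) (nabla Z x u)) x where
  smul := by
    intro f Y hf hY
    have h1 := mvfderiv_mul hf (mdifferentiableAt_inner g hY hZ)
    have e : (fun y => g.inner y ((f • Y) y) (Z y)) =
        f * fun y => g.inner y (Y y) (Z y) := by ext y; simp
    have h2 := nabla.isCovariantDerivativeOnUniv.leibniz hY hf
    rw [e, h1, h2]
    simp
    ring
  add := by
    intro Y Y' hY hY'
    have h1 := mvfderiv_add (mdifferentiableAt_inner g hY hZ) (mdifferentiableAt_inner g hY' hZ)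
    have e : (fun y => g.inner y ((Y + Y') y) (Z y)) =
        (fun y => g.inner y (Y y) (Z y)) + fun y => g.inner y (Y' y) (Z y) := by ext y; simp
    have h2 := nabla.isCovariantDerivativeOnUniv.add hY hY'
    rw [e, h1, h2]
    simp
    ring

/-- Torsion and metric defect are tensors, so left-invariant fields suffice. On those, inner
products are constant, their derivatives vanish, and the two identities become `htor` and `hskew`.
-/
lemma IsInvariantConnection.isLeviCivita {nabla : TangentConnection I G}
    {Γ : GroupLieAlgebra I G →ₗ[ℝ] GroupLieAlgebra I G →ₗ[ℝ] GroupLieAlgebra I G}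
    (h : IsInvariantConnection nabla Γ) {g : RiemMetric I G} (hg : IsLeftInvariant g.inner)
    (htor : ∀ a b, Γ a b - Γ b a = ⁅a, b⁆)
    (hskew : ∀ a b c, g.inner 1 (Γ a b) c + g.inner 1 b (Γ a c) = 0) :
    IsLeviCivita g nabla where
  torsionFree := by
    have : CompleteSpace E := FiniteDimensional.complete ℝ E
    have : IsManifold I 2 G := inferInstance
    have key : nabla.torsion = 0 := by
      ext x u v
      obtain ⟨a, rfl⟩ := (leftTriv x).surjective u
      obtain ⟨b, rfl⟩ := (leftTriv x).surjective v
      have := nabla.torsion_apply (mdifferentiableAt_mulInvariantVectorField' a x)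
        (mdifferentiableAt_mulInvariantVectorField' b x)
      rw [h, h, mlieBracket_mulInvariantVectorField, ← htor] at this
      simp only [leftTriv_apply, this]
      simp only [← leftTriv_apply, map_sub]
      simp
    intro X Y x hX hY
    exact nabla.torsion_eq_zero_iff.1 key hX hY
  metricCompatible := by
    intro Y Z x u hY hZ
    rw [← sub_eq_zero, ← sub_sub]
    have key := TensorialAt.pointwise₂ (I := I) (F := E) (F' := E) (x := x)
      (Φ := fun Y Z : ∀ x : G, TangentSpace I x => d% (fun y => g.inner y (Y y) (Z y)) x u
      - g.inner x (nabla Y x u) (Z x) - g.inner x (Y x) (nabla Z x u))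
      (fun Z hZ => tensorialAt_metricDefect g nabla x u Z hZ)
      (fun Y hY => by
        convert! tensorialAt_metricDefect g nabla x u Y hY using 2 with Z
        simp only [g.symm _ (Y _)]
        rw [g.symm _ (nabla Y x u)]
        ring) hY
      (mdifferentiableAt_mulInvariantVectorField' ((leftTriv x).symm (Y x)) x) hZ
      (mdifferentiableAt_mulInvariantVectorField' ((leftTriv x).symm (Z x)) x) (by simp) (by simp)
    refine key.trans ?_
    obtain ⟨a, rfl⟩ := (leftTriv x).surjective u
    simp only [hg.apply_mulInvariantVectorField, leftTriv_apply, h x, mvfderiv_const]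
    have := hskew a ((leftTriv x).symm (Y x)) ((leftTriv x).symm (Z x))
    simp
    linarith

/-- On left-invariant fields the Levi-Civita connection of a left-invariant metric is determined
by the torsion-free skew-symmetric bilinear map `Γ`. -/
lemma IsLeviCivita.isInvariantConnection {g : RiemMetric I G} {nabla : TangentConnection I G}
    (h : IsLeviCivita g nabla) (hg : IsLeftInvariant g.inner)
    {Γ : GroupLieAlgebra I G →ₗ[ℝ] GroupLieAlgebra I G →ₗ[ℝ] GroupLieAlgebra I G}
    (htor : ∀ a b, Γ a b - Γ b a = ⁅a, b⁆)
    (hskew : ∀ a b c, g.inner 1 (Γ a b) c + g.inner 1 b (Γ a c) = 0) :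
    IsInvariantConnection nabla Γ := by
  intro x
  -- The difference of the two connections at `x`: symmetric because the torsions agree, skew
  -- because both are metric.
  let D : GroupLieAlgebra I G → GroupLieAlgebra I G → GroupLieAlgebra I G := fun a b =>
    (leftTriv x).symm (nabla (mulInvariantVectorField b) x (mulInvariantVectorField a x)) - Γ a b
  have hD : ∀ a b, nabla (mulInvariantVectorField b) x (mulInvariantVectorField a x) =
      mulInvariantVectorField (D a b + Γ a b) x := by
    intro a b
    simp [D]
  have hsymm : ∀ a b, D a b = D b a := by
    intro a b
    have h1 := h.torsionFree _ _ x (mdifferentiableAt_mulInvariantVectorField' a x)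
      (mdifferentiableAt_mulInvariantVectorField' b x)
    rw [hD, hD, mlieBracket_mulInvariantVectorField, ← htor] at h1
    simp only [← leftTriv_apply, ← map_sub] at h1
    have h2 := (leftTriv x).injective h1
    rw [← sub_eq_zero] at h2 ⊢
    rw [← h2]
    abel
  have hsk : ∀ a b c, g.inner 1 (D a b) c + g.inner 1 b (D a c) = 0 := by
    intro a b c
    have h1 := h.metricCompatible _ _ x (mulInvariantVectorField a x)
      (mdifferentiableAt_mulInvariantVectorField' b x)
      (mdifferentiableAt_mulInvariantVectorField' c x)
    simp only [hD, hg.apply_mulInvariantVectorField, mvfderiv_const] at h1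
    have h2 := hskew a b c
    simp at h1
    linarith
  have h0 : ∀ a b, D a b = 0 := by
    intro a b
    -- Koszul's argument: a form symmetric in its first two arguments and skew in its last two
    -- vanishes, by permuting cyclically.
    have h3 : ∀ a b c, g.inner 1 (D a b) c = 0 := by
      intro a b c
      have e1 := hsk a b c
      have e2 := hsk b c a
      have e3 := hsk c a b
      rw [g.symm 1 b] at e1
      rw [g.symm 1 c] at e2
      rw [g.symm 1 a] at e3
      rw [hsymm c a] at e3
      rw [hsymm b a] at e2
      rw [hsymm c b] at e3
      linarith
    by_contra hne
    exact (g.pos 1 _ hne).ne' (h3 a b _)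
  intro a b
  rw [hD, h0, zero_add]

end InvariantConnections

/-! ### Curvature on the Lie algebra -/

section InvariantCurvature

variable {E : Type*} [NormedAddCommGroup E] [NormedSpace ℝ E] [FiniteDimensional ℝ E]
  {H : Type*} [TopologicalSpace H] {I : ModelWithCorners ℝ E H}
  {G : Type*} [TopologicalSpace G] [ChartedSpace H G] [Group G] [LieGroup I ∞ G]

/-- The map `u ↦ R(u, b) c` on the Lie algebra, where `R` is the curvature of the torsion-free
invariant connection `Γ`. -/
def algebraicCurvature {L : Type*} [AddCommGroup L] [Module ℝ L] (Γ : L →ₗ[ℝ] L →ₗ[ℝ] L)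
    (b c : L) : L →ₗ[ℝ] L :=
  Γ.flip (Γ b c) - Γ b ∘ₗ Γ.flip c - Γ.flip c ∘ₗ (Γ.flip b - Γ b)

lemma algebraicCurvature_apply {L : Type*} [AddCommGroup L] [Module ℝ L]
    (Γ : L →ₗ[ℝ] L →ₗ[ℝ] L) (a b c : L) :
    algebraicCurvature Γ b c a = Γ a (Γ b c) - Γ b (Γ a c) - Γ (Γ a b - Γ b a) c := rfl

variable {nabla : TangentConnection I G}
    {Γ : GroupLieAlgebra I G →ₗ[ℝ] GroupLieAlgebra I G →ₗ[ℝ] GroupLieAlgebra I G}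

lemma IsInvariantConnection.curvature_eq (h : IsInvariantConnection nabla Γ)
    (htor : ∀ a b, Γ a b - Γ b a = ⁅a, b⁆) (x : G) (a b c : GroupLieAlgebra I G) :
    curvature nabla (mulInvariantVectorField a) (mulInvariantVectorField b)
      (mulInvariantVectorField c) x = leftTriv x (algebraicCurvature Γ b c a) := by
  have h1 : ∀ a b : GroupLieAlgebra I G, (fun y : G => nabla (mulInvariantVectorField b) y
      (mulInvariantVectorField a y)) = mulInvariantVectorField (Γ a b) :=
    fun a b => funext fun y => h y a b
  rw [curvature, h1, h1, h, h, mlieBracket_mulInvariantVectorField, h, algebraicCurvature_apply,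
    htor, map_sub, map_sub]
  simp

/-- Left-invariant fields take every value at `x`, so the endomorphism in `IsRicciTensor` is forced
to be the conjugate of `algebraicCurvature` by `leftTriv x`, and conjugation preserves the trace. -/
lemma IsInvariantConnection.isRicciTensor_iff (h : IsInvariantConnection nabla Γ)
    (htor : ∀ a b, Γ a b - Γ b a = ⁅a, b⁆) (S : TwoTensorField I G) :
    IsRicciTensor nabla S ↔ ∀ (x : G) (b c : GroupLieAlgebra I G),
      S x (mulInvariantVectorField b x) (mulInvariantVectorField c x) =
        LinearMap.trace ℝ (GroupLieAlgebra I G) (algebraicCurvature Γ b c) := by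
  refine forall_congr' fun x => forall_congr' fun b => forall_congr' fun c => ?_
  have htr : LinearMap.trace ℝ (TangentSpace I x)
      ((leftTriv x).toLinearEquiv.conj (algebraicCurvature Γ b c)) =
      LinearMap.trace ℝ (GroupLieAlgebra I G) (algebraicCurvature Γ b c) :=
    LinearMap.trace_conj' _ _
  constructor
  · rintro ⟨A, hA, hS⟩
    rw [← hS, ← htr]
    congr 1
    ext v
    obtain ⟨a, rfl⟩ := (leftTriv x).surjective v
    rw [leftTriv_apply, hA, h.curvature_eq htor]
    simp [LinearEquiv.conj_apply]
  · intro hS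
    refine ⟨(leftTriv x).toLinearEquiv.conj (algebraicCurvature Γ b c), fun a => ?_, ?_⟩
    · rw [h.curvature_eq htor]
      simp [LinearEquiv.conj_apply]
    · rw [htr, hS]

/-- The Ricci equation of a left-invariant metric, in terms of the bilinear map `Γ` on the Lie
algebra which gives its Levi-Civita connection. -/
lemma ricciEq_iff_trace {g : RiemMetric I G} (hg : IsLeftInvariant g.inner)
    (htor : ∀ a b, Γ a b - Γ b a = ⁅a, b⁆)
    (hskew : ∀ a b c, g.inner 1 (Γ a b) c + g.inner 1 b (Γ a c) = 0)
    {S : TwoTensorField I G} (hS : IsLeftInvariant S) :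
    RicciEq g S ↔ ∀ b c : GroupLieAlgebra I G,
      S 1 b c = LinearMap.trace ℝ (GroupLieAlgebra I G) (algebraicCurvature Γ b c) := by
  constructor
  · rintro ⟨nabla, hn, hR⟩ b c
    rw [← hS.apply_mulInvariantVectorField 1 b c]
    exact ((hn.isInvariantConnection hg htor hskew).isRicciTensor_iff htor S).1 hR 1 b c
  · intro h
    have hinv := isInvariantConnection_invariantConnection
      (Module.finBasis ℝ (GroupLieAlgebra I G)) Γ
    refine ⟨_, hinv.isLeviCivita hg htor hskew, (hinv.isRicciTensor_iff htor S).2 fun x b c => ?_⟩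
    rw [hS.apply_mulInvariantVectorField, h]

end InvariantCurvature

/-! ### Ricci curvature in a Milnor basis -/

section MilnorRicci

variable {E : Type*} [NormedAddCommGroup E] [NormedSpace ℝ E] [FiniteDimensional ℝ E]
  {H : Type*} [TopologicalSpace H] {I : ModelWithCorners ℝ E H}
  {G : Type*} [TopologicalSpace G] [ChartedSpace H G] [Group G] [LieGroup I ∞ G]

/-- The Levi-Civita connection of the inner product `diag(x, y, z)` in a Milnor basis. -/
noncomputable def milnorConnection {L : Type*} [AddCommGroup L] [Module ℝ L]
    (V : Module.Basis (Fin 3) ℝ L) (x y z : ℝ) : L →ₗ[ℝ] L →ₗ[ℝ] L :=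
  V.constr ℝ fun i => V.constr ℝ fun j =>
    (!![0, ((y - x) / z) • V 2, ((x - y) / y) • V 1;
      ((y - x) / z) • V 2, 0, ((x - y) / x) • V 0;
      ((x + y) / y) • V 1, (-((x + y) / x)) • V 0, 0] : Matrix (Fin 3) (Fin 3) L) i j

lemma milnorConnection_basis {L : Type*} [AddCommGroup L] [Module ℝ L]
    (V : Module.Basis (Fin 3) ℝ L) (x y z : ℝ) (i j : Fin 3) :
    milnorConnection V x y z (V i) (V j) =
    (!![0, ((y - x) / z) • V 2, ((x - y) / y) • V 1;
      ((y - x) / z) • V 2, 0, ((x - y) / x) • V 0;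
      ((x + y) / y) • V 1, (-((x + y) / x)) • V 0, 0] : Matrix (Fin 3) (Fin 3) L) i j := by
  simp [milnorConnection]

lemma milnorConnection_torsion {V : Module.Basis (Fin 3) ℝ (GroupLieAlgebra I G)}
    (hV : IsMilnorBasis V 2 2 0) {x y z : ℝ} (hx : x ≠ 0) (hy : y ≠ 0)
    (a b : GroupLieAlgebra I G) :
    milnorConnection V x y z a b - milnorConnection V x y z b a = ⁅a, b⁆ := by
  obtain ⟨h1, h2, h3⟩ := hV
  have key : milnorConnection V x y z - (milnorConnection V x y z).flip =
      (LieModule.toEnd ℝ (GroupLieAlgebra I G) (GroupLieAlgebra I G) :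
        GroupLieAlgebra I G →ₗ[ℝ] Module.End ℝ (GroupLieAlgebra I G)) := by
    refine V.ext fun i => V.ext fun j => ?_
    have h1' : ⁅V 1, V 0⁆ = -((0 : ℝ) • V 2) := by rw [← lie_skew, h1]
    have h2' : ⁅V 2, V 1⁆ = -((2 : ℝ) • V 0) := by rw [← lie_skew, h2]
    have h3' : ⁅V 0, V 2⁆ = -((2 : ℝ) • V 1) := by rw [← lie_skew, h3]
    have e1 : (x + y) / y = (x - y) / y + 2 := by field_simp; ring
    have e2 : (x + y) / x = 2 - (x - y) / x := by field_simp; ring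
    fin_cases i <;> fin_cases j <;>
      simp [milnorConnection_basis, h1, h2, h3, h1', h2', h3', e1, e2, sub_smul, add_smul]
  exact LinearMap.congr_fun (LinearMap.congr_fun key a) b

omit [FiniteDimensional ℝ E] in
lemma milnorConnection_skew {g : RiemMetric I G}
    {V : Module.Basis (Fin 3) ℝ (GroupLieAlgebra I G)} {x y z : ℝ}
    (hx : x ≠ 0) (hy : y ≠ 0) (hz : z ≠ 0) (hg : IsDiagIn g.inner V x y z)
    (a b c : GroupLieAlgebra I G) :
    g.inner 1 (milnorConnection V x y z a b) c +
      g.inner 1 b (milnorConnection V x y z a c) = 0 := by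
  let B : GroupLieAlgebra I G →ₗ[ℝ] GroupLieAlgebra I G →ₗ[ℝ] ℝ :=
    LinearMap.mk₂ ℝ (fun u v => g.inner 1 u v) (by simp) (by simp) (by simp) (by simp)
  have hB : ∀ i j, B (V i) (V j) = Matrix.diagonal ![x, y, z] i j := hg
  have hbasis : ∀ i j k, B (milnorConnection V x y z (V k) (V i)) (V j) +
      B (V i) (milnorConnection V x y z (V k) (V j)) = 0 := by
    intro i j k
    fin_cases i <;> fin_cases j <;> fin_cases k <;>
      simp [milnorConnection_basis, hB] <;> field_simp <;> ring
  have h1 : ∀ i j, B.flip (V j) ∘ₗ (milnorConnection V x y z).flip (V i) +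
      B (V i) ∘ₗ (milnorConnection V x y z).flip (V j) = 0 :=
    fun i j => V.ext fun k => hbasis i j k
  have h2 : B ∘ₗ milnorConnection V x y z a + (B.flip ∘ₗ milnorConnection V x y z a).flip = 0 :=
    V.ext fun i => V.ext fun j => LinearMap.congr_fun (h1 i j) a
  exact LinearMap.congr_fun (LinearMap.congr_fun h2 b) c

/-- The bracket enters `algebraicCurvature` only through Γ a b - Γ b a, so this is a computation in
a vector space with a basis. -/
lemma trace_milnorCurvature {L : Type*} [AddCommGroup L] [Module ℝ L]
    (V : Module.Basis (Fin 3) ℝ L) {x y z : ℝ} (hx : x ≠ 0) (hy : y ≠ 0) (hz : z ≠ 0)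
    (i j : Fin 3) :
    LinearMap.trace ℝ L (algebraicCurvature (milnorConnection V x y z) (V i) (V j)) =
      Matrix.diagonal ![2 * (x ^ 2 - y ^ 2) / (y * z), 2 * (y ^ 2 - x ^ 2) / (x * z),
        -(2 * (x - y) ^ 2 / (x * y))] i j := by
  rw [LinearMap.trace_eq_matrix_trace ℝ V, Matrix.trace, Fin.sum_univ_three]
  simp only [Matrix.diag_apply, LinearMap.toMatrix_apply, algebraicCurvature_apply]
  fin_cases i <;> fin_cases j <;>
    simp [milnorConnection_basis] <;> field_simp <;> ring

/-- The Ricci curvature of a left-invariant metric which is diagonal in a Milnor basis. -/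
lemma ricciEq_iff_isDiagIn {g : RiemMetric I G} (hg : IsLeftInvariant g.inner)
    {V : Module.Basis (Fin 3) ℝ (GroupLieAlgebra I G)} (hV : IsMilnorBasis V 2 2 0) {x y z : ℝ}
    (hx : x ≠ 0) (hy : y ≠ 0) (hz : z ≠ 0) (hd : IsDiagIn g.inner V x y z)
    {S : TwoTensorField I G} (hS : IsLeftInvariant S) :
    RicciEq g S ↔ IsDiagIn S V (2 * (x ^ 2 - y ^ 2) / (y * z)) (2 * (y ^ 2 - x ^ 2) / (x * z))
      (-(2 * (x - y) ^ 2 / (x * y))) := by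
  rw [ricciEq_iff_trace hg (milnorConnection_torsion hV hx hy)
    (milnorConnection_skew hx hy hz hd) hS]
  constructor
  · intro h i j
    rw [h, trace_milnorCurvature V hx hy hz]
  · intro h
    -- Both sides are bilinear, so equality on basis vectors is enough.
    let B : GroupLieAlgebra I G →ₗ[ℝ] GroupLieAlgebra I G →ₗ[ℝ] ℝ :=
      LinearMap.mk₂ ℝ (fun u v => S 1 u v) (by simp) (by simp) (by simp) (by simp)
    let Γ := milnorConnection V x y z
    let R : GroupLieAlgebra I G →ₗ[ℝ] GroupLieAlgebra I G →ₗ[ℝ] ℝ :=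
      LinearMap.mk₂ ℝ (fun b c => LinearMap.trace ℝ _ (algebraicCurvature Γ b c))
        (fun b b' c => by
          rw [← map_add]; congr 1; ext a; simp [algebraicCurvature_apply]; abel)
        (fun r b c => by
          rw [← map_smul]; congr 1; ext a; simp [algebraicCurvature_apply, smul_sub])
        (fun b c c' => by
          rw [← map_add]; congr 1; ext a; simp [algebraicCurvature_apply]; abel)
        (fun r b c => by
          rw [← map_smul]; congr 1; ext a; simp [algebraicCurvature_apply, smul_sub])
    have key : B = R := V.ext fun i => V.ext fun j =>
      (h i j).trans (trace_milnorCurvature V hx hy hz i j).symm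
    exact fun b c => LinearMap.congr_fun (LinearMap.congr_fun key b) c

end MilnorRicci

/-! ### A Milnor basis of the Euclidean algebra -/

section EuclideanMilnor

attribute [local instance] LieRing.ofAssociativeRing

/-- The translations and twice the infinitesimal rotation, as a basis of the Lie algebra of the
group of motions of the plane. -/
noncomputable def euclideanBasis : Module.Basis (Fin 3) ℝ euclideanLieAlgebra :=
  Module.Basis.ofEquivFun
    -- Halving the rotation coordinate doubles the third basis vector, which turns the structure
    -- constants 1 into 2.
    { toFun := fun A => ![A.1 0 2, A.1 1 2, A.1 1 0 / 2]
      map_add' := fun A B => by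
        ext i; fin_cases i <;> simp [add_div]
      map_smul' := fun r A => by
        ext i; fin_cases i <;> simp [mul_div_assoc]
      invFun := fun v => ⟨!![0, -(2 * v 2), v 0; 2 * v 2, 0, v 1; 0, 0, 0],
        by simp, by simp, by simp, fun j => by fin_cases j <;> simp⟩
      left_inv := fun A => by
        obtain ⟨A, h0, h1, h2, h3⟩ := A
        ext i j
        have h4 : A 0 1 = - A 1 0 := by rw [h2, neg_neg]
        fin_cases i <;> fin_cases j <;> simp [h0, h1, h3, h4] <;> ring
      right_inv := fun v => by
        ext i; fin_cases i <;> simp }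

lemma euclideanBasis_coe (i : Fin 3) : (euclideanBasis i : Matrix (Fin 3) (Fin 3) ℝ) =
    ![!![0, 0, 1; 0, 0, 0; 0, 0, 0], !![0, 0, 0; 0, 0, 1; 0, 0, 0],
      !![0, -2, 0; 2, 0, 0; 0, 0, 0]] i := by
  fin_cases i <;> simp [euclideanBasis]

lemma euclideanBasis_lie : ⁅euclideanBasis 0, euclideanBasis 1⁆ = (0 : ℝ) • euclideanBasis 2 ∧
    ⁅euclideanBasis 1, euclideanBasis 2⁆ = (2 : ℝ) • euclideanBasis 0 ∧
    ⁅euclideanBasis 2, euclideanBasis 0⁆ = (2 : ℝ) • euclideanBasis 1 := by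
  refine ⟨?_, ?_, ?_⟩ <;> apply Subtype.ext <;>
    rw [LieSubalgebra.coe_bracket, SetLike.val_smul, Ring.lie_def] <;>
    ext i j <;> fin_cases i <;> fin_cases j <;> simp [euclideanBasis_coe]

end EuclideanMilnor

/-! ### Milnor bases adapted to a metric -/

section MilnorBasis

variable {E : Type*} [NormedAddCommGroup E] [NormedSpace ℝ E]
  {H : Type*} [TopologicalSpace H] {I : ModelWithCorners ℝ E H}
  {G : Type*} [TopologicalSpace G] [ChartedSpace H G] [Group G] [LieGroup I ∞ G]

lemma exists_isMilnorBasis [CompleteSpace E]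
    (hG : Nonempty (GroupLieAlgebra I G ≃ₗ⁅ℝ⁆ euclideanLieAlgebra)) :
    ∃ V : Module.Basis (Fin 3) ℝ (GroupLieAlgebra I G), IsMilnorBasis V 2 2 0 := by
  obtain ⟨e⟩ := hG
  obtain ⟨h1, h2, h3⟩ := euclideanBasis_lie
  refine ⟨euclideanBasis.map e.symm.toLinearEquiv, ?_, ?_, ?_⟩
  · have := congrArg e.symm h1
    rw [LieEquiv.map_lie] at this
    exact this.trans (map_smul e.symm.toLinearEquiv _ _)
  · have := congrArg e.symm h2
    rw [LieEquiv.map_lie] at this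
    exact this.trans (map_smul e.symm.toLinearEquiv _ _)
  · have := congrArg e.symm h3
    rw [LieEquiv.map_lie] at this
    exact this.trans (map_smul e.symm.toLinearEquiv _ _)

/-- The change of basis which rotates the plane of the first two vectors and shears the third. -/
lemma exists_basis_rotate_shear {L : Type*} [AddCommGroup L] [Module ℝ L]
    (V : Module.Basis (Fin 3) ℝ L) {a b : ℝ} (hab : a ^ 2 + b ^ 2 = 1) (p q : ℝ) :
    ∃ W : Module.Basis (Fin 3) ℝ L, W 0 = a • V 0 + b • V 1 ∧ W 1 = (-b) • V 0 + a • V 1 ∧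
      W 2 = V 2 + p • V 0 + q • V 1 := by
  let w : Fin 3 → L := ![a • V 0 + b • V 1, (-b) • V 0 + a • V 1, V 2 + p • V 0 + q • V 1]
  have hw : LinearIndependent ℝ w := by
    rw [Fintype.linearIndependent_iff]
    intro g hg
    have h0 := congrArg (fun v => V.repr v 0) hg
    have h1 := congrArg (fun v => V.repr v 1) hg
    have h2 := congrArg (fun v => V.repr v 2) hg
    simp [w, Fin.sum_univ_three] at h0 h1 h2
    rw [h2] at h0 h1
    have e0 : g 0 = 0 := by linear_combination a * h0 + b * h1 - g 0 * hab
    have e1 : g 1 = 0 := by linear_combination (-b) * h0 + a * h1 - g 1 * hab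
    intro i
    fin_cases i
    exacts [e0, e1, h2]
  have hcard : Fintype.card (Fin 3) = Module.finrank ℝ L :=
    (Module.finrank_eq_card_basis V).symm
  refine ⟨basisOfLinearIndependentOfCardEqFinrank hw hcard, ?_, ?_, ?_⟩ <;> simp [w]

/-- Plane rotations commute with the quarter turn given by `ad (V 2)`, and adding elements of the
abelian ideal to `V 2` does not change its action on that ideal. -/
lemma IsMilnorBasis.rotate_shear [CompleteSpace E]
    {V W : Module.Basis (Fin 3) ℝ (GroupLieAlgebra I G)}
    (hV : IsMilnorBasis V 2 2 0) {a b p q : ℝ}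
    (h0 : W 0 = a • V 0 + b • V 1) (h1 : W 1 = (-b) • V 0 + a • V 1)
    (h2 : W 2 = V 2 + p • V 0 + q • V 1) : IsMilnorBasis W 2 2 0 := by
  obtain ⟨e1, e2, e3⟩ := hV
  have e1' : ⁅V 1, V 0⁆ = -((0 : ℝ) • V 2) := by rw [← lie_skew, e1]
  have e2' : ⁅V 2, V 1⁆ = -((2 : ℝ) • V 0) := by rw [← lie_skew, e2]
  have e3' : ⁅V 0, V 2⁆ = -((2 : ℝ) • V 1) := by rw [← lie_skew, e3]
  refine ⟨?_, ?_, ?_⟩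
  · rw [h0, h1]
    simp [e1, e1']
  · rw [h0, h1, h2]
    simp [e1, e1', e2, e3']
    module
  · rw [h0, h1, h2]
    simp [e1, e1', e3, e2']
    module

/-- Quadratic forms in two variables are diagonalised by a rotation. -/
lemma exists_rotation (A B : ℝ) :
    ∃ a b : ℝ, a ^ 2 + b ^ 2 = 1 ∧ a * b * A + (a ^ 2 - b ^ 2) * B = 0 := by
  -- With a = cos θ, b = sin θ the equation reads (A/2) sin 2θ + B cos 2θ = 0, so 2θ may be the
  -- argument of A/2 - iB.
  let z : ℂ := ⟨A / 2, -B⟩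
  refine ⟨Real.cos (z.arg / 2), Real.sin (z.arg / 2), Real.cos_sq_add_sin_sq _, ?_⟩
  have hc : ‖z‖ * Real.cos z.arg = A / 2 := Complex.norm_mul_cos_arg z
  have hs : ‖z‖ * Real.sin z.arg = -B := Complex.norm_mul_sin_arg z
  have h2 : z.arg = 2 * (z.arg / 2) := by ring
  have e1 : Real.sin z.arg = 2 * Real.sin (z.arg / 2) * Real.cos (z.arg / 2) := by
    conv_lhs => rw [h2, Real.sin_two_mul]
  have e2 : Real.cos z.arg = Real.cos (z.arg / 2) ^ 2 - Real.sin (z.arg / 2) ^ 2 := by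
    conv_lhs => rw [h2, Real.cos_two_mul']
  have e3 : A = 2 * (‖z‖ * Real.cos z.arg) := by linarith
  have e4 : B = -(‖z‖ * Real.sin z.arg) := by linarith
  rw [← e2, e3, e4]
  linear_combination ‖z‖ * Real.cos z.arg * (-e1)

/-- Every left-invariant metric is diagonal in a Milnor basis, obtained from a given one by a
rotation and a shear. -/
lemma exists_isDiagIn_metric (g : RiemMetric I G)
    (V : Module.Basis (Fin 3) ℝ (GroupLieAlgebra I G)) :
    ∃ (W : Module.Basis (Fin 3) ℝ (GroupLieAlgebra I G)) (a b p q x y z : ℝ),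
      a ^ 2 + b ^ 2 = 1 ∧ W 0 = a • V 0 + b • V 1 ∧ W 1 = (-b) • V 0 + a • V 1 ∧
      W 2 = V 2 + p • V 0 + q • V 1 ∧ 0 < x ∧ 0 < y ∧ 0 < z ∧ IsDiagIn g.inner W x y z := by
  set h : Fin 3 → Fin 3 → ℝ := fun i j => g.inner 1 (V i) (V j) with hh
  have hs : ∀ i j, h i j = h j i := fun i j => g.symm 1 _ _
  have h11 : 0 < h 1 1 := g.pos 1 _ (V.ne_zero 1)
  have hdet : 0 < h 0 0 * h 1 1 - h 0 1 ^ 2 := by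
    -- A multiple of the part of `V 0` orthogonal to `V 1`; its squared length is `h 1 1` times the
    -- Gram determinant.
    have hne : h 1 1 • V 0 - h 0 1 • V 1 ≠ 0 := by
      intro h0
      have := congrArg (fun v => V.repr v 0) h0
      simp at this
      exact h11.ne' this
    have := g.pos 1 _ hne
    have e : g.inner 1 (h 1 1 • V 0 - h 0 1 • V 1) (h 1 1 • V 0 - h 0 1 • V 1) =
        h 1 1 * (h 0 0 * h 1 1 - h 0 1 ^ 2) := by
      have := hs 1 0
      simp only [hh] at this ⊢
      simp [this]
      ring
    rw [e] at this
    exact (pos_iff_pos_of_mul_pos this).1 h11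
  obtain ⟨a, b, hab, hrot⟩ := exists_rotation (h 1 1 - h 0 0) (h 0 1)
  set D := h 0 0 * h 1 1 - h 0 1 ^ 2 with hD
  -- The shear coefficients are Cramer's solution of the two equations making `W 2` orthogonal to `V
  -- 0` and `V 1`.
  obtain ⟨W, h0, h1, h2⟩ := exists_basis_rotate_shear V hab
    ((h 0 1 * h 1 2 - h 1 1 * h 0 2) / D) ((h 0 1 * h 0 2 - h 0 0 * h 1 2) / D)
  refine ⟨W, a, b, _, _, g.inner 1 (W 0) (W 0), g.inner 1 (W 1) (W 1), g.inner 1 (W 2) (W 2), hab,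
    h0, h1, h2, g.pos 1 _ (W.ne_zero 0), g.pos 1 _ (W.ne_zero 1), g.pos 1 _ (W.ne_zero 2), ?_⟩
  have r0 : g.inner 1 (V 0) (W 2) = 0 := by
    have e : g.inner 1 (V 0) (W 2) = h 0 2 + (h 0 1 * h 1 2 - h 1 1 * h 0 2) / D * h 0 0 +
        (h 0 1 * h 0 2 - h 0 0 * h 1 2) / D * h 0 1 := by
      rw [h2]; simp [hh]
    rw [e]
    field_simp
    rw [hD]
    ring
  have r1 : g.inner 1 (V 1) (W 2) = 0 := by
    have e : g.inner 1 (V 1) (W 2) = h 1 2 + (h 0 1 * h 1 2 - h 1 1 * h 0 2) / D * h 0 1 +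
        (h 0 1 * h 0 2 - h 0 0 * h 1 2) / D * h 1 1 := by
      rw [h2, hs 0 1]; simp [hh]
    rw [e]
    field_simp
    rw [hD]
    ring
  have w01 : g.inner 1 (W 0) (W 1) = 0 := by
    rw [← hrot, h0, h1]
    have := hs 1 0
    simp only [hh] at this ⊢
    simp [this]
    ring
  have w02 : g.inner 1 (W 0) (W 2) = 0 := by
    rw [h0]; simp [r0, r1]
  have w12 : g.inner 1 (W 1) (W 2) = 0 := by
    rw [h1]; simp [r0, r1]
  intro i j
  fin_cases i <;> fin_cases j
  · simp
  · simpa using w01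
  · simpa using w02
  · simpa using (g.symm 1 _ _).trans w01
  · simp
  · simpa using w12
  · simpa using (g.symm 1 _ _).trans w02
  · simpa using (g.symm 1 _ _).trans w12
  · simp

end MilnorBasis

/-! ### Solving the prescribed Ricci equation -/

section Solutions

variable {E : Type*} [NormedAddCommGroup E] [NormedSpace ℝ E] [FiniteDimensional ℝ E]
  {H : Type*} [TopologicalSpace H] {I : ModelWithCorners ℝ E H}
  {G : Type*} [TopologicalSpace G] [ChartedSpace H G] [Group G] [LieGroup I ∞ G]
  {V W : Module.Basis (Fin 3) ℝ (GroupLieAlgebra I G)} {T : TwoTensorField I G}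

omit [FiniteDimensional ℝ E] [LieGroup I ∞ G] in
lemma IsLeftInvariant.smul (hT : IsLeftInvariant T) (c : ℝ) :
    IsLeftInvariant (fun x => c • T x) := by
  intro a x u v
  simpa using congrArg (c * ·) (hT a x u v)

omit [FiniteDimensional ℝ E] [LieGroup I ∞ G] in
lemma isDiagIn_iff {S : TwoTensorField I G} {x y z : ℝ} : IsDiagIn S V x y z ↔
    (S 1 (V 0) (V 0) = x ∧ S 1 (V 1) (V 1) = y ∧ S 1 (V 2) (V 2) = z) ∧
    (S 1 (V 0) (V 1) = 0 ∧ S 1 (V 1) (V 0) = 0 ∧ S 1 (V 0) (V 2) = 0 ∧ S 1 (V 2) (V 0) = 0 ∧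
      S 1 (V 1) (V 2) = 0 ∧ S 1 (V 2) (V 1) = 0) := by
  constructor
  · intro h
    simp [h _ _]
  · rintro ⟨⟨h1, h2, h3⟩, h4, h5, h6, h7, h8, h9⟩ i j
    fin_cases i <;> fin_cases j <;> simp_all

omit [FiniteDimensional ℝ E] [LieGroup I ∞ G] in
lemma isDiagIn_smul_iff {c : ℝ} (hc : c ≠ 0) {x y z : ℝ} :
    IsDiagIn (fun p => c • T p) V x y z ↔ IsDiagIn T V (x / c) (y / c) (z / c) := by
  simp only [isDiagIn_iff, smul_apply, smul_eq_mul, mul_eq_zero, hc, or_false,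
    eq_div_iff hc, mul_comm c]

/-- The prescribed Ricci curvature equation for a metric which is diagonal in a Milnor basis. -/
lemma isRicciSolution_iff (hT : IsLeftInvariant T) (hV : IsMilnorBasis V 2 2 0)
    {g : RiemMetric I G} (hg : IsLeftInvariant g.inner) {x y z : ℝ} (hx : 0 < x) (hy : 0 < y)
    (hz : 0 < z) (hd : IsDiagIn g.inner V x y z) {c : ℝ} (hc : 0 < c) :
    IsRicciSolution T g c ↔ IsDiagIn T V (2 * (x ^ 2 - y ^ 2) / (y * z) / c)
      (2 * (y ^ 2 - x ^ 2) / (x * z) / c) (-(2 * (x - y) ^ 2 / (x * y)) / c) := by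
  rw [← isDiagIn_smul_iff hc.ne', ← ricciEq_iff_isDiagIn hg hV hx.ne' hy.ne' hz.ne' hd (hT.smul c)]
  exact ⟨fun h => h.2.2, fun h => ⟨hg, hc, h⟩⟩

lemma isDiagIn_diagMetric (d : Fin 3 → ℝ) (hd : ∀ i, 0 < d i) :
    IsDiagIn (diagMetric V d hd).inner V (d 0) (d 1) (d 2) := by
  have h := diagMetric_inner_apply V d hd 1
  simp only [mulInvariantVectorField_one] at h
  rw [isDiagIn_iff]
  simp [h, Fin.sum_univ_three]

omit [FiniteDimensional ℝ E] in
lemma IsDiagIn.isHomothetic {g g' : RiemMetric I G} (hg : IsLeftInvariant g.inner)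
    (hg' : IsLeftInvariant g'.inner) {x y z k : ℝ} (hk : 0 < k) (hd : IsDiagIn g.inner V x y z)
    (hd' : IsDiagIn g'.inner V (k * x) (k * y) (k * z)) : IsHomothetic g g' := by
  refine ⟨k, hk, fun p => ?_⟩
  let B : RiemMetric I G → GroupLieAlgebra I G →ₗ[ℝ] GroupLieAlgebra I G →ₗ[ℝ] ℝ := fun g =>
    LinearMap.mk₂ ℝ (fun u v => g.inner 1 u v) (by simp) (by simp) (by simp) (by simp)
  have key : B g' = k • B g := V.ext fun i => V.ext fun j => by
    have h1 : B g (V i) (V j) = _ := hd i j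
    have h2 : B g' (V i) (V j) = _ := hd' i j
    simp only [LinearMap.smul_apply, h1, h2]
    fin_cases i <;> fin_cases j <;> simp
  ext u v
  obtain ⟨a, rfl⟩ := (leftTriv p).surjective u
  obtain ⟨b, rfl⟩ := (leftTriv p).surjective v
  simp only [leftTriv_apply, smul_apply, hg.apply_mulInvariantVectorField,
    hg'.apply_mulInvariantVectorField]
  exact LinearMap.congr_fun (LinearMap.congr_fun key a) b

/-- In a Milnor basis in which the Ricci curvature is diagonal with entries of the given signs, the
metric is diagonal. -/
lemma IsRicciSolution.exists_isDiagIn (hT : IsLeftInvariant T) (hV : IsMilnorBasis V 2 2 0)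
    {T₁ T₂ T₃ : ℝ} (hTV : IsDiagIn T V T₁ T₂ T₃) (h12 : T₁ * T₂ < 0) {g : RiemMetric I G} {c : ℝ}
    (h : IsRicciSolution T g c) :
    ∃ x y z : ℝ, 0 < x ∧ 0 < y ∧ 0 < z ∧ IsDiagIn g.inner V x y z := by
  have : CompleteSpace E := FiniteDimensional.complete ℝ E
  obtain ⟨W, a, b, p, q, x, y, z, hab, h0, h1, h2, hx, hy, hz, hd⟩ := exists_isDiagIn_metric g V
  -- `T` is diagonal in `W` too, being proportional to a Ricci tensor diagonal there. Comparing with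
  -- `V` restricts the rotation and the shear.
  have hTW := (isRicciSolution_iff hT (hV.rotate_shear h0 h1 h2) h.1 hx hy hz hd h.2.1).1 h
  obtain ⟨-, t01, -, t02, -, t12, -⟩ := isDiagIn_iff.1 hTW
  obtain ⟨⟨u0, u1, u2⟩, u01, u10, u02, u20, u12, u21⟩ := isDiagIn_iff.1 hTV
  rw [h0, h1] at t01
  rw [h0, h2] at t02
  rw [h1, h2] at t12
  simp [u0, u1, u01, u10, u02, u12] at t01 t02 t12
  have hT₁ : T₁ ≠ 0 := by rintro rfl; simp at h12
  have hT₂ : T₂ ≠ 0 := by rintro rfl; simp at h12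
  -- The equations for T(W 0, W 2) and T(W 1, W 2) are the rotation applied to (p T₁, q T₂);
  -- inverting it gives p T₁ = q T₂ = 0.
  have hp : p = 0 := by
    have : p * T₁ = 0 := by linear_combination a * t02 - b * t12 - p * T₁ * hab
    exact (mul_eq_zero.1 this).resolve_right hT₁
  have hq : q = 0 := by
    have : q * T₂ = 0 := by linear_combination b * t02 + a * t12 - q * T₂ * hab
    exact (mul_eq_zero.1 this).resolve_right hT₂
  -- Opposite signs force T₁ ≠ T₂, so the rotation is a multiple of a quarter turn and keeps `g`
  -- diagonal.
  have hab0 : a * b = 0 := by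
    have h3 : a * b * (T₂ - T₁) = 0 := by linear_combination t01
    refine (mul_eq_zero.1 h3).resolve_right fun h4 => ?_
    rw [sub_eq_zero.1 h4] at h12
    exact h12.not_ge (mul_self_nonneg _)
  obtain ⟨⟨g0, g1, g2⟩, g01, g10, g02, g20, g12, g21⟩ := isDiagIn_iff.1 hd
  have e0 : V 0 = a • W 0 - b • W 1 := by
    rw [h0, h1]
    conv_lhs => rw [← one_smul ℝ (V 0), ← hab]
    module
  have e1 : V 1 = b • W 0 + a • W 1 := by
    rw [h0, h1]
    conv_lhs => rw [← one_smul ℝ (V 1), ← hab]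
    module
  have e2 : V 2 = W 2 := by rw [h2, hp, hq]; simp
  have d01 : g.inner 1 (V 0) (V 1) = 0 := by
    rw [e0, e1]
    simp [g0, g1, g01, g10]
    linear_combination (x - y) * hab0
  have d02 : g.inner 1 (V 0) (V 2) = 0 := by
    rw [e0, e2]
    simp [g02, g12]
  have d12 : g.inner 1 (V 1) (V 2) = 0 := by
    rw [e1, e2]
    simp [g02, g12]
  exact ⟨_, _, _, g.pos 1 _ (V.ne_zero 0), g.pos 1 _ (V.ne_zero 1), g.pos 1 _ (V.ne_zero 2),
    isDiagIn_iff.2 ⟨⟨rfl, rfl, rfl⟩, d01, (g.symm 1 _ _).trans d01, d02, (g.symm 1 _ _).trans d02,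
      d12, (g.symm 1 _ _).trans d12⟩⟩

/-- The Ricci curvature of any left-invariant metric has the signs of the classification. -/
lemma IsRicciSolution.exists_milnorBasis (hT : IsLeftInvariant T) (hV : IsMilnorBasis V 2 2 0)
    {g : RiemMetric I G} {c : ℝ} (h : IsRicciSolution T g c) :
    ∃ (W : Module.Basis (Fin 3) ℝ (GroupLieAlgebra I G)) (T₁ T₂ T₃ : ℝ),
        IsMilnorBasis W 2 2 0 ∧ IsDiagIn T W T₁ T₂ T₃ ∧
        ((T₁ = 0 ∧ T₂ = 0 ∧ T₃ = 0) ∨ (0 < T₁ + T₂ ∧ T₃ < 0 ∧ T₁ * T₂ < 0)) := by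
  have : CompleteSpace E := FiniteDimensional.complete ℝ E
  obtain ⟨W, a, b, p, q, x, y, z, hab, h0, h1, h2, hx, hy, hz, hd⟩ := exists_isDiagIn_metric g V
  have hW := hV.rotate_shear h0 h1 h2
  refine ⟨W, _, _, _, hW, (isRicciSolution_iff hT hW h.1 hx hy hz hd h.2.1).1 h, ?_⟩
  have hc := h.2.1
  rcases eq_or_ne x y with rfl | hxy
  · left
    simp
  · right
    have hsq : 0 < (x - y) ^ 2 := sq_pos_of_ne_zero (sub_ne_zero.2 hxy)
    refine ⟨?_, ?_, ?_⟩
    · have : 2 * (x ^ 2 - y ^ 2) / (y * z) / c + 2 * (y ^ 2 - x ^ 2) / (x * z) / c =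
          2 * (x - y) ^ 2 * (x + y) / (x * y * z * c) := by
        field_simp
        ring
      rw [this]
      positivity
    · rw [neg_div, neg_lt_zero]
      positivity
    · have : 2 * (x ^ 2 - y ^ 2) / (y * z) / c * (2 * (y ^ 2 - x ^ 2) / (x * z) / c) =
          -(4 * ((x - y) ^ 2 * (x + y) ^ 2) / (x * y * z ^ 2 * c ^ 2)) := by
        field_simp
        ring
      rw [this, neg_lt_zero]
      positivity

/-- The Ricci-flat metrics form infinitely many homothety classes. -/
lemma exists_infinite_ricciSolution (hT : IsLeftInvariant T) (hV : IsMilnorBasis V 2 2 0)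
    (hTV : IsDiagIn T V 0 0 0) {c : ℝ} (hc : 0 < c) :
    ∃ S : Set (RiemMetric I G), S.Infinite ∧ (∀ g ∈ S, IsRicciSolution T g c) ∧
      S.Pairwise fun g g' => ¬ IsHomothetic g g' := by
  have hpos : ∀ (n : ℕ) (i : Fin 3), 0 < (![1, 1, (n : ℝ) + 1] : Fin 3 → ℝ) i := by
    intro n i
    fin_cases i <;> simp
    positivity
  -- Equal first two entries make every member flat; the ratio of third to first entry is a
  -- homothety invariant separating them.
  let f : ℕ → RiemMetric I G := fun n => diagMetric V ![1, 1, (n : ℝ) + 1] (hpos n)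
  have hd : ∀ n, IsDiagIn (f n).inner V 1 1 ((n : ℝ) + 1) := fun n =>
    isDiagIn_diagMetric _ (hpos n)
  have hhom : ∀ m n, IsHomothetic (f m) (f n) → m = n := by
    rintro m n ⟨k, hk, h⟩
    obtain ⟨⟨a0, a1, a2⟩, -⟩ := isDiagIn_iff.1 (hd m)
    obtain ⟨⟨b0, b1, b2⟩, -⟩ := isDiagIn_iff.1 (hd n)
    rw [h] at b0 b2
    simp only [smul_apply, a0, a2, smul_eq_mul] at b0 b2
    have : (m : ℝ) = n := by linear_combination b2 - ((m : ℝ) + 1) * b0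
    exact_mod_cast this
  refine ⟨Set.range f, Set.infinite_range_of_injective fun m n h => hhom m n ?_, ?_, ?_⟩
  · rw [h]
    exact ⟨1, one_pos, fun x => (one_smul ℝ _).symm⟩
  · rintro _ ⟨n, rfl⟩
    rw [isRicciSolution_iff hT hV (isLeftInvariant_diagMetric _ _ _) one_pos one_pos
      (by positivity) (hd n) hc]
    simpa using hTV
  · rintro _ ⟨m, rfl⟩ _ ⟨n, rfl⟩ hne h
    exact hne (by rw [hhom m n h])

/-- Existence and uniqueness for a nonzero tensor with the signs of the classification. -/
lemma exists_unique_ricciSolution (hT : IsLeftInvariant T) (hV : IsMilnorBasis V 2 2 0)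
    {T₁ T₂ T₃ : ℝ} (hTV : IsDiagIn T V T₁ T₂ T₃) (hadd : 0 < T₁ + T₂) (h3 : T₃ < 0)
    (h12 : T₁ * T₂ < 0) :
    ∃ (g : RiemMetric I G) (c : ℝ), IsRicciSolution T g c ∧
      ∀ (g' : RiemMetric I G) (c' : ℝ), IsRicciSolution T g' c' → c' = c ∧ IsHomothetic g g' := by
  have hT₁ : T₁ ≠ 0 := by rintro rfl; simp at h12
  have hT₂ : T₂ ≠ 0 := by rintro rfl; simp at h12
  -- The ratio x/y forced by the first two Ricci entries.
  obtain ⟨r, hr⟩ : ∃ r, r = -T₁ / T₂ := ⟨_, rfl⟩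
  have hr1 : T₁ = -r * T₂ := by rw [hr]; field_simp
  have hr0 : 0 < r := by
    have : 0 < T₂ ^ 2 := by positivity
    rw [hr1] at h12
    nlinarith
  have hrT : 0 < (1 - r) * T₂ := by rw [hr1] at hadd; linarith
  have hr2 : r - 1 ≠ 0 := by
    intro h
    have : 1 - r = 0 := by linarith
    rw [this] at hrT
    simp at hrT
  have hr3 : 0 < (r - 1) ^ 2 := by positivity
  -- The third equation depends on x and y only through `r`; it is solved here for c.
  obtain ⟨c, hcdef⟩ : ∃ c, c = 2 * (r - 1) ^ 2 / (r * -T₃) := ⟨_, rfl⟩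
  have hT₃ : 0 < -T₃ := by linarith
  have hc : 0 < c := by rw [hcdef]; positivity
  -- The second equation at x = r, y = 1, solved for z; the extra factor T₂ above and below makes
  -- positivity visible from `hrT`.
  obtain ⟨z, hzdef⟩ : ∃ z, z = 2 * ((1 - r) * T₂) * (r + 1) / (r * T₂ ^ 2 * c) := ⟨_, rfl⟩
  have hz : 0 < z := by rw [hzdef]; positivity
  have hpos : ∀ i : Fin 3, 0 < (![r, 1, z] : Fin 3 → ℝ) i := by
    intro i
    fin_cases i <;> simp [hr0, hz]
  have hd := isDiagIn_diagMetric (V := V) _ hpos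
  refine ⟨diagMetric V _ hpos, c, ?_, ?_⟩
  · rw [isRicciSolution_iff hT hV (isLeftInvariant_diagMetric _ _ _) hr0 one_pos hz hd hc]
    convert hTV using 1
    · rw [hzdef, hr1]
      have : 1 - r ≠ 0 := by contrapose! hr2; linarith
      field_simp
      ring
    · rw [hzdef]
      have : 1 - r ≠ 0 := by contrapose! hr2; linarith
      field_simp
      ring
    · rw [hcdef]
      have : T₃ ≠ 0 := h3.ne
      field_simp
  · intro g' c' h
    obtain ⟨x', y', z', hx', hy', hz', hd'⟩ := h.exists_isDiagIn hT hV hTV h12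
    have hc' := h.2.1
    have hT' := (isRicciSolution_iff hT hV h.1 hx' hy' hz' hd' hc').1 h
    obtain ⟨⟨u1, u2, u3⟩, -⟩ := isDiagIn_iff.1 hTV
    obtain ⟨⟨w1, w2, w3⟩, -⟩ := isDiagIn_iff.1 hT'
    rw [u1] at w1
    rw [u2] at w2
    rw [u3] at w3
    have hx : x' = r * y' := by
      have hne : x' ^ 2 - y' ^ 2 ≠ 0 := by
        intro h0
        apply hT₁
        rw [w1, h0]
        simp
      rw [hr, w1, w2, show y' ^ 2 - x' ^ 2 = -(x' ^ 2 - y' ^ 2) by ring]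
      field_simp
    subst hx
    have hcc : c' = c := by
      rw [hcdef, w3]
      field_simp
    -- The reference metric has second entry 1, so the homothety factor is y'.
    refine ⟨hcc, hd.isHomothetic (isLeftInvariant_diagMetric _ _ _) h.1 hy' ?_⟩
    have hz2 : z' = y' * z := by
      rw [hzdef, ← hcc, w2]
      have : 1 - r ≠ 0 := by contrapose! hr2; linarith
      have : 1 - r ^ 2 ≠ 0 := by
        rw [show 1 - r ^ 2 = (1 - r) * (1 + r) by ring]
        positivity
      have : y' ^ 2 - (r * y') ^ 2 = (1 - r ^ 2) * y' ^ 2 := by ring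
      rw [this]
      field_simp
      ring
    convert hd' using 1
    · simp [mul_comm]
    · simp
    · simp [hz2]

end Solutions

theorem mainTheorem4 {G : Type*} [TopologicalSpace G] [ChartedSpace (EuclideanSpace ℝ (Fin 3)) G]
    [Group G] [LieGroup (𝓡 3) ∞ G]
    (hG : Nonempty (GroupLieAlgebra (𝓡 3) G ≃ₗ⁅ℝ⁆ euclideanLieAlgebra))
    (T : TwoTensorField (𝓡 3) G) (hT : IsLeftInvariant T) :
    ((∃ (g : RiemMetric (𝓡 3) G) (c : ℝ), IsRicciSolution T g c) ↔
      ∃ (V : Module.Basis (Fin 3) ℝ (GroupLieAlgebra (𝓡 3) G)) (T₁ T₂ T₃ : ℝ),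
        IsMilnorBasis V 2 2 0 ∧ IsDiagIn T V T₁ T₂ T₃ ∧
        ((T₁ = 0 ∧ T₂ = 0 ∧ T₃ = 0) ∨ (0 < T₁ + T₂ ∧ T₃ < 0 ∧ T₁ * T₂ < 0))) ∧
    (∀ (V : Module.Basis (Fin 3) ℝ (GroupLieAlgebra (𝓡 3) G)) (T₁ T₂ T₃ : ℝ),
      IsMilnorBasis V 2 2 0 → IsDiagIn T V T₁ T₂ T₃ →
      (T₁ = 0 ∧ T₂ = 0 ∧ T₃ = 0 →
        ∀ c : ℝ, 0 < c → ∃ S : Set (RiemMetric (𝓡 3) G), S.Infinite ∧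
          (∀ g ∈ S, IsRicciSolution T g c) ∧ S.Pairwise fun g g' => ¬ IsHomothetic g g') ∧
      (0 < T₁ + T₂ ∧ T₃ < 0 ∧ T₁ * T₂ < 0 →
        ∃ (g : RiemMetric (𝓡 3) G) (c : ℝ), IsRicciSolution T g c ∧
          ∀ (g' : RiemMetric (𝓡 3) G) (c' : ℝ), IsRicciSolution T g' c' →
            c' = c ∧ IsHomothetic g g')) := by

  have hcase : ∀ (V : Module.Basis (Fin 3) ℝ (GroupLieAlgebra (𝓡 3) G)) (T₁ T₂ T₃ : ℝ),
      IsMilnorBasis V 2 2 0 → IsDiagIn T V T₁ T₂ T₃ →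
      (T₁ = 0 ∧ T₂ = 0 ∧ T₃ = 0 →
        ∀ c : ℝ, 0 < c → ∃ S : Set (RiemMetric (𝓡 3) G), S.Infinite ∧
          (∀ g ∈ S, IsRicciSolution T g c) ∧ S.Pairwise fun g g' => ¬ IsHomothetic g g') ∧
      (0 < T₁ + T₂ ∧ T₃ < 0 ∧ T₁ * T₂ < 0 →
        ∃ (g : RiemMetric (𝓡 3) G) (c : ℝ), IsRicciSolution T g c ∧
          ∀ (g' : RiemMetric (𝓡 3) G) (c' : ℝ), IsRicciSolution T g' c' →
            c' = c ∧ IsHomothetic g g') := by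
    intro V T₁ T₂ T₃ hV hTV
    refine ⟨?_, fun h => exists_unique_ricciSolution hT hV hTV h.1 h.2.1 h.2.2⟩
    rintro ⟨rfl, rfl, rfl⟩ c hc
    exact exists_infinite_ricciSolution hT hV hTV hc
  refine ⟨⟨?_, ?_⟩, hcase⟩
  · rintro ⟨g, c, h⟩
    obtain ⟨V, hV⟩ := exists_isMilnorBasis hG
    exact h.exists_milnorBasis hT hV
  · rintro ⟨V, T₁, T₂, T₃, hV, hTV, h | h⟩
    · obtain ⟨S, hS, hsol, -⟩ := (hcase V T₁ T₂ T₃ hV hTV).1 h 1 one_pos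
      obtain ⟨g, hg⟩ := hS.nonempty
      exact ⟨g, 1, hsol g hg⟩
    · obtain ⟨g, c, hgc, -⟩ := (hcase V T₁ T₂ T₃ hV hTV).2 h
      exact ⟨g, c, hgc⟩
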